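/- Let $k$ be a real number. For $\operatorname{Re}(s)>-\tfrac12$ the integral $$W_1(k;s)=\frac{1}{2\pi i}\int_{|x|=1}\bigl|k+x+x^{-1}\bigr|^{s}\,\frac{dx}{x}$$ converges absolutely, and the function $s\mapsto W_1(k;s)$ extends from this half-plane to a meromorphic function on $\mathbb{C}$, denoted in the same way. Call a zero $s$ of this meromorphic function *trivial* if $|k|<2$ and $s\in\{-2,-4,-6,\dots\}$, or if $|k|=2$ and $s\in\{-1,-2,-3,\dots\}$; for $|k|>2$ no zero is trivial. Then every non-trivial zero $s$ of $W_1(k;\cdot)$ satisfies $\operatorname{Re}(s)=-\tfrac12$. -/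

import Mathlib

/-- The integrand `x ↦ |k + x + x⁻¹|^s * x⁻¹` of the zeta Mahler function of the Laurent
polynomial `k + x + x⁻¹`. -/
noncomputable def zmfIntegrand (k : ℝ) (s x : ℂ) : ℂ :=
  ((‖(k : ℂ) + (x + x⁻¹)‖ : ℝ) : ℂ) ^ s * x⁻¹

/-- The integral `(1 / (2 π i)) ∫_{|x| = 1} |k + x + x⁻¹|^s dx / x` that defines `W₁(k; s)` where it
converges. -/
noncomputable def zmfIntegral (k : ℝ) (s : ℂ) : ℂ :=
  (2 * (Real.pi : ℂ) * Complex.I)⁻¹ * ∮ x in C(0, 1), zmfIntegrand k s x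

/-- `W` represents the meromorphic function `s ↦ W₁(k; s)` on the complex plane: it is meromorphic
on all of `ℂ` and agrees with the defining integral on the half-plane `Re s > -1/2`, on which the
integral converges for every real `k`. (By the identity theorem two such functions can differ
only on a discrete set, so all such `W` have the same order at every point.) -/
def IsW₁ (k : ℝ) (W : ℂ → ℂ) : Prop :=
  Meromorphic W ∧ ∀ s : ℂ, -1 / 2 < s.re → W s = zmfIntegral k s

/-- `s` is a zero of the meromorphic function `W`: the order of `W` at `s` is positive. This excludes
poles and does not depend on the value that is assigned to `W` at the point `s`. -/
def IsMeromorphicZero (W : ℂ → ℂ) (s : ℂ) : Prop :=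
  0 < meromorphicOrderAt W s

/-- The places of the trivial zeros of `s ↦ W₁(k; s)`, those of its Gamma factors: none if `2 < |k|`,
the negative integers if `|k| = 2`, the negative even integers if `|k| < 2`. -/
def trivialZeros (k : ℝ) : Set ℂ :=
  {s | (|k| = 2 ∧ ∃ n : ℕ, s = -((n : ℂ) + 1)) ∨ (|k| < 2 ∧ ∃ n : ℕ, s = -(2 * ((n : ℂ) + 1)))}

/-!
# Zeros of the zeta Mahler function of `k + x + x⁻¹`

On the unit circle `x + x⁻¹ = 2 cos θ`, so `2 π W₁(k; s)` is the period integral of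
`|k + 2 cos θ| ^ s`, which depends on `|k|` only.

If `|k| ≠ 2`, a hyperbolic substitution turns the period integral into a Legendre function. For
`k = 2 coth r` and for `k = 2 tanh r` it is an elementary nonvanishing factor times the Laplace
integral of `|cosh r + sinh r cos θ| ^ s`, respectively of `|sinh r + cosh r cos θ| ^ s`. As a
function of `r` this integral satisfies `(p J')' = s (s + 1) p J` with `p = sinh`, respectively
`p = cosh` (`hasDerivAt_mul_laplaceDeriv`), and `p J'` vanishes at `r = 0`. This is a symmetric
eigenvalue problem: a zero of `J` at some `r > 0` makes `s (s + 1)` real (`im_eq_zero_of_zero`),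
that is, `s` is real or `Re s = -1/2`.

* For `|k| > 2` the period integral is entire in `s`, and it is positive for real `s`.
* For `|k| < 2` the even solution `evenSol` of the equation, normalised by the value `1` at
  `r = 0`, is entire in `s`, since it is a power series in `l = s (s + 1)`. By uniqueness for the
  initial value problem and the identity theorem, the period integral is a constant times
  `(2 / cosh r) ^ s * Γ((s + 1) / 2) / Γ(s / 2 + 1) * evenSol (s (s + 1)) r`
  (`periodIntegral_two_mul_tanh`), which is its meromorphic continuation. The Gamma quotient, the
  Beta integral at `k = 0`, contributes the trivial zeros, and a Hardy-type inequality shows that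
  `evenSol l r = 0` forces `l < -1/4` (`re_lt_of_zero_cosh`), which is `Re s = -1/2`.
* For `|k| = 2` the period integral is a constant times `4 ^ s * Γ(s + 1 / 2) / Γ(s + 1)`, whose
  zeros are all trivial.

In each case the continuation is a quotient of entire functions (`exists_quotient`), and any other
continuation has the same order at every point by the identity theorem for meromorphic functions.
-/

namespace ZetaMahler

open Set Filter Topology MeasureTheory

open scoped Real

/-! ### Complex powers of the absolute value -/

/-- The function `u ↦ |u| ^ s` of a real variable, with a complex exponent `s`. -/
noncomputable def absCpow (s : ℂ) (u : ℝ) : ℂ := ((|u| : ℝ) : ℂ) ^ s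

lemma absCpow_of_ne (s : ℂ) {u : ℝ} (hu : u ≠ 0) :
    absCpow s u = Complex.exp (s * (Real.log u : ℝ)) := by
  have h : ((|u| : ℝ) : ℂ) ≠ 0 := by exact_mod_cast abs_ne_zero.2 hu
  rw [absCpow, Complex.cpow_def_of_ne_zero h, ← Complex.ofReal_log (abs_nonneg u), Real.log_abs,
    mul_comm]

lemma absCpow_zero {s : ℂ} (hs : s ≠ 0) : absCpow s 0 = 0 := by
  simp [absCpow, hs]

lemma absCpow_neg (s : ℂ) (u : ℝ) : absCpow s (-u) = absCpow s u := by
  simp [absCpow]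

lemma absCpow_mul (s : ℂ) (u v : ℝ) : absCpow s (u * v) = absCpow s u * absCpow s v := by
  rw [absCpow, abs_mul, Complex.ofReal_mul,
    Complex.mul_cpow_ofReal_nonneg (abs_nonneg u) (abs_nonneg v), absCpow, absCpow]

lemma continuous_absCpow {s : ℂ} (hs : 0 < s.re) : Continuous (absCpow s) :=
  (Complex.continuous_ofReal_cpow_const hs).comp continuous_abs

/-- The disjunction `u ≠ 0 ∨ 2 < s.re` is the condition under which `|u| ^ s` is twice
continuously differentiable at `u`; the derivatives of `|u| ^ s` and of `u * |u| ^ (s - 2)` are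
then `s * (u * |u| ^ (s - 2))` and `(s - 1) * |u| ^ (s - 2)`. -/
lemma sq_mul_absCpow_sub_two {s : ℂ} {u : ℝ} (h : u ≠ 0 ∨ 2 < s.re) :
    (u : ℂ) * (u * absCpow (s - 2) u) = absCpow s u := by
  rcases eq_or_ne u 0 with rfl | hu
  · have hs : s ≠ 0 := by
      rintro rfl
      norm_num at h
    simp [absCpow_zero hs]
  · have h2 : ((|u| : ℝ) : ℂ) ≠ 0 := by exact_mod_cast abs_ne_zero.2 hu
    have h3 : ((|u| : ℝ) : ℂ) ^ 2 = (u : ℂ) ^ 2 := by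
      rw [← Complex.ofReal_pow, sq_abs, Complex.ofReal_pow]
    rw [absCpow, absCpow, Complex.cpow_sub _ _ h2, Complex.cpow_ofNat, h3]
    have h4 : (u : ℂ) ≠ 0 := by exact_mod_cast hu
    field_simp

lemma continuousAt_absCpow_sub_two {s : ℂ} {u : ℝ} (h : u ≠ 0 ∨ 2 < s.re) :
    ContinuousAt (absCpow (s - 2)) u := by
  rcases h with hu | hs
  · have : absCpow (s - 2) =ᶠ[𝓝 u] fun u => Complex.exp ((s - 2) * (Real.log u : ℝ)) := by
      filter_upwards [isOpen_ne.mem_nhds hu] with x hx using absCpow_of_ne _ hx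
    rw [continuousAt_congr this]
    have := Real.continuousAt_log hu
    fun_prop
  · exact (continuous_absCpow (by simpa using hs)).continuousAt

lemma hasDerivAt_absCpow_of_ne (s : ℂ) {u : ℝ} (hu : u ≠ 0) :
    HasDerivAt (absCpow s) (s * (u * absCpow (s - 2) u)) u := by
  have h : absCpow s =ᶠ[𝓝 u] fun u => Complex.exp (s * (Real.log u : ℝ)) := by
    filter_upwards [isOpen_ne.mem_nhds hu] with x hx using absCpow_of_ne _ hx
  have h1 := ((Real.hasDerivAt_log hu).ofReal_comp.const_mul s).cexp
  refine HasDerivAt.congr_of_eventuallyEq (h1.congr_deriv ?_) h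
  have h4 : (u : ℂ) ≠ 0 := by exact_mod_cast hu
  rw [← absCpow_of_ne s hu, ← sq_mul_absCpow_sub_two (s := s) (Or.inl hu)]
  push_cast
  field_simp

lemma hasDerivAt_absCpow {s : ℂ} {u : ℝ} (h : u ≠ 0 ∨ 2 < s.re) :
    HasDerivAt (absCpow s) (s * (u * absCpow (s - 2) u)) u := by
  rcases eq_or_ne u 0 with rfl | hu
  · have hs : 2 < s.re := by simpa using h
    have hs0 : s ≠ 0 := by
      rintro rfl
      norm_num at hs
    rw [hasDerivAt_iff_tendsto_slope_zero]
    have h1 : Tendsto (fun t : ℝ => (t : ℂ) * absCpow (s - 2) t) (𝓝[≠] 0) (𝓝 0) := by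
      have : Continuous fun t : ℝ => (t : ℂ) * absCpow (s - 2) t :=
        Complex.continuous_ofReal.mul (continuous_absCpow (by simpa using hs))
      simpa using (this.tendsto 0).mono_left nhdsWithin_le_nhds
    simp only [Complex.ofReal_zero, zero_mul, mul_zero]
    refine h1.congr' ?_
    filter_upwards [self_mem_nhdsWithin] with t ht
    have ht : (t : ℂ) ≠ 0 := by exact_mod_cast ht
    rw [zero_add, absCpow_zero hs0, ← sq_mul_absCpow_sub_two (Or.inr hs), Complex.real_smul]
    push_cast
    field_simp
    simp
  · exact hasDerivAt_absCpow_of_ne s hu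

lemma hasDerivAt_mul_absCpow {s : ℂ} {u : ℝ} (h : u ≠ 0 ∨ 2 < s.re) :
    HasDerivAt (fun u : ℝ => (u : ℂ) * absCpow (s - 2) u) ((s - 1) * absCpow (s - 2) u) u := by
  rcases eq_or_ne u 0 with rfl | hu
  · have hs : 2 < s.re := by simpa using h
    have hs0 : s - 2 ≠ 0 := by
      intro h0
      rw [sub_eq_zero.1 h0] at hs
      norm_num at hs
    rw [hasDerivAt_iff_tendsto_slope_zero]
    have h1 : Tendsto (absCpow (s - 2)) (𝓝[≠] 0) (𝓝 0) := by
      have : Continuous (absCpow (s - 2)) := continuous_absCpow (by simpa using hs)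
      simpa [absCpow_zero hs0] using (this.tendsto 0).mono_left nhdsWithin_le_nhds
    simp only [absCpow_zero hs0, mul_zero]
    refine h1.congr' ?_
    filter_upwards [self_mem_nhdsWithin] with t ht
    have ht : (t : ℂ) ≠ 0 := by exact_mod_cast ht
    rw [zero_add, Complex.real_smul]
    push_cast
    field_simp
    simp
  · have h1 := (hasDerivAt_id u).ofReal_comp.mul (hasDerivAt_absCpow_of_ne (s - 2) hu)
    refine h1.congr_deriv ?_
    have := sq_mul_absCpow_sub_two (s := s - 2) (Or.inl hu)
    simp only [id, Complex.ofReal_one]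
    linear_combination (s - 2) * this

/-! ### Laplace integrals and the Legendre equation -/

lemma hasDerivAt_intervalIntegral_of_continuous {F F' : ℝ → ℝ → ℂ}
    (hF : ∀ r θ, HasDerivAt (fun r => F r θ) (F' r θ) r) (hFc : ∀ r, Continuous (F r))
    (hF' : Continuous fun p : ℝ × ℝ => F' p.1 p.2) (a b r : ℝ) :
    HasDerivAt (fun r => ∫ θ in a..b, F r θ) (∫ θ in a..b, F' r θ) r := by
  obtain ⟨C, hC⟩ := ((isCompact_closedBall r 1).prod (isCompact_uIcc (a := a) (b := b))
    ).exists_bound_of_continuousOn hF'.continuousOn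
  refine (intervalIntegral.hasDerivAt_integral_of_dominated_loc_of_deriv_le (bound := fun _ => C)
    (Metric.closedBall_mem_nhds r one_pos) ?_ ((hFc r).intervalIntegrable _ _) ?_ ?_
    (by simp) ?_).2
  · exact Eventually.of_forall fun r => (hFc r).aestronglyMeasurable
  · exact (hF'.comp (by fun_prop : Continuous fun θ : ℝ => (r, θ))).aestronglyMeasurable
  · exact Eventually.of_forall fun θ hθ x hx => hC (x, θ) ⟨hx, uIoc_subset_uIcc hθ⟩
  · exact Eventually.of_forall fun θ hθ x hx => hF x θ

/-- The Laplace-type integral `∫ |a(r) + b(r) cos θ| ^ s dθ` over a period. It is used for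
`(a, b) = (sinh, cosh)` and `(a, b) = (cosh, sinh)`. -/
noncomputable def laplace (a b : ℝ → ℝ) (s : ℂ) (r : ℝ) : ℂ :=
  ∫ θ in (0 : ℝ)..2 * Real.pi, absCpow s (a r + b r * Real.cos θ)

/-- The derivative of `laplace a b s` when `a' = b` and `b' = a`. -/
noncomputable def laplaceDeriv (a b : ℝ → ℝ) (s : ℂ) (r : ℝ) : ℂ :=
  ∫ θ in (0 : ℝ)..2 * Real.pi, s * (((a r + b r * Real.cos θ : ℝ) : ℂ) *
    absCpow (s - 2) (a r + b r * Real.cos θ)) * ((b r + a r * Real.cos θ : ℝ) : ℂ)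

section Laplace

variable {a b : ℝ → ℝ} {s : ℂ} {ε : ℝ}

lemma hasDerivAt_laplace (ha : ∀ r, HasDerivAt a (b r) r) (hb : ∀ r, HasDerivAt b (a r) r)
    (h : ∀ r θ, a r + b r * Real.cos θ ≠ 0 ∨ 2 < s.re) (r : ℝ) :
    HasDerivAt (laplace a b s) (laplaceDeriv a b s r) r := by
  have hac : Continuous a := continuous_iff_continuousAt.2 fun r => (ha r).continuousAt
  have hbc : Continuous b := continuous_iff_continuousAt.2 fun r => (hb r).continuousAt
  have hu : ∀ r θ, HasDerivAt (fun r => a r + b r * Real.cos θ) (b r + a r * Real.cos θ) r :=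
    fun r θ => (ha r).add ((hb r).mul_const _)
  have hc : Continuous fun p : ℝ × ℝ => absCpow (s - 2) (a p.1 + b p.1 * Real.cos p.2) :=
    continuous_iff_continuousAt.2 fun p =>
      (continuousAt_absCpow_sub_two (h p.1 p.2)).comp_of_eq (by fun_prop) rfl
  refine hasDerivAt_intervalIntegral_of_continuous
    (F := fun r θ => absCpow s (a r + b r * Real.cos θ))
    (F' := fun r θ => s * (((a r + b r * Real.cos θ : ℝ) : ℂ) *
      absCpow (s - 2) (a r + b r * Real.cos θ)) * ((b r + a r * Real.cos θ : ℝ) : ℂ))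
    (fun r θ => ?_) (fun r => ?_) ?_ _ _ r
  · refine ((hasDerivAt_absCpow (h r θ)).scomp r (hu r θ)).congr_deriv ?_
    rw [Complex.real_smul]
    ring
  · exact continuous_iff_continuousAt.2 fun θ =>
      (hasDerivAt_absCpow (h r θ)).continuousAt.comp_of_eq (by fun_prop) rfl
  · fun_prop

/-- The Legendre equation `(b J')' = s (s + 1) b J` for `J = laplace a b s`. With
`u = a + b cos θ` and `v = b + a cos θ` one has `∂u/∂r = v`, `∂v/∂r = u` and `v² = u² + ε sin² θ`,
and the two sides differ by `s ε` times the integral over a period of the `θ`-derivative of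
`sin θ * (u * |u| ^ (s - 2))`. -/
lemma hasDerivAt_mul_laplaceDeriv (ha : ∀ r, HasDerivAt a (b r) r)
    (hb : ∀ r, HasDerivAt b (a r) r) (hab : ∀ r, b r ^ 2 - a r ^ 2 = ε)
    (h : ∀ r θ, a r + b r * Real.cos θ ≠ 0 ∨ 2 < s.re) (r : ℝ) :
    HasDerivAt (fun r => (b r : ℂ) * laplaceDeriv a b s r)
      (s * (s + 1) * b r * laplace a b s r) r := by
  have hac : Continuous a := continuous_iff_continuousAt.2 fun r => (ha r).continuousAt
  have hbc : Continuous b := continuous_iff_continuousAt.2 fun r => (hb r).continuousAt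
  have hu : ∀ r θ, HasDerivAt (fun r => a r + b r * Real.cos θ) (b r + a r * Real.cos θ) r :=
    fun r θ => (ha r).add ((hb r).mul_const _)
  have hv : ∀ r θ, HasDerivAt (fun r => b r + a r * Real.cos θ) (a r + b r * Real.cos θ) r :=
    fun r θ => (hb r).add ((ha r).mul_const _)
  have huθ : ∀ θ, HasDerivAt (fun θ => a r + b r * Real.cos θ) (b r * -Real.sin θ) θ :=
    fun θ => ((Real.hasDerivAt_cos θ).const_mul (b r)).const_add _
  have hc : Continuous fun p : ℝ × ℝ => absCpow (s - 2) (a p.1 + b p.1 * Real.cos p.2) :=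
    continuous_iff_continuousAt.2 fun p =>
      (continuousAt_absCpow_sub_two (h p.1 p.2)).comp_of_eq (by fun_prop) rfl
  have hcr : Continuous fun θ : ℝ => absCpow (s - 2) (a r + b r * Real.cos θ) :=
    hc.comp (by fun_prop : Continuous fun θ : ℝ => (r, θ))
  -- the second derivative in `r`
  have h2 : HasDerivAt (laplaceDeriv a b s) (∫ θ in (0 : ℝ)..2 * Real.pi,
      (s * ((s - 1) * absCpow (s - 2) (a r + b r * Real.cos θ)) *
        ((b r + a r * Real.cos θ : ℝ) : ℂ) ^ 2 + s * absCpow s (a r + b r * Real.cos θ))) r := by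
    refine hasDerivAt_intervalIntegral_of_continuous (F' := fun r θ =>
      s * ((s - 1) * absCpow (s - 2) (a r + b r * Real.cos θ)) *
        ((b r + a r * Real.cos θ : ℝ) : ℂ) ^ 2 + s * absCpow s (a r + b r * Real.cos θ))
      (fun r θ => ?_) (fun r => ?_) ?_ _ _ r
    · have h3 := (((hasDerivAt_mul_absCpow (h r θ)).scomp r (hu r θ)).const_mul s).mul
        (hv r θ).ofReal_comp
      refine h3.congr_deriv ?_
      rw [Complex.real_smul]
      have := sq_mul_absCpow_sub_two (h r θ)
      simp only [Function.comp]
      linear_combination s * this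
    · have : Continuous fun θ : ℝ => absCpow (s - 2) (a r + b r * Real.cos θ) :=
        hc.comp (by fun_prop : Continuous fun θ : ℝ => (r, θ))
      fun_prop
    · have : (fun p : ℝ × ℝ => absCpow s (a p.1 + b p.1 * Real.cos p.2)) =
          fun p : ℝ × ℝ => ((a p.1 + b p.1 * Real.cos p.2 : ℝ) : ℂ) *
            (((a p.1 + b p.1 * Real.cos p.2 : ℝ) : ℂ) *
              absCpow (s - 2) (a p.1 + b p.1 * Real.cos p.2)) := by
        ext p
        exact (sq_mul_absCpow_sub_two (h p.1 p.2)).symm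
      have : Continuous (fun p : ℝ × ℝ => absCpow s (a p.1 + b p.1 * Real.cos p.2)) := by
        rw [this]
        fun_prop
      fun_prop
  -- integration of an exact derivative over a period
  have h4 : ∫ θ in (0 : ℝ)..2 * Real.pi, ((Real.cos θ : ℂ) *
      (((a r + b r * Real.cos θ : ℝ) : ℂ) * absCpow (s - 2) (a r + b r * Real.cos θ)) -
      (s - 1) * absCpow (s - 2) (a r + b r * Real.cos θ) * b r * (Real.sin θ : ℂ) ^ 2) = 0 := by
    rw [intervalIntegral.integral_eq_sub_of_hasDerivAt (f := fun θ : ℝ => (Real.sin θ : ℂ) *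
      (((a r + b r * Real.cos θ : ℝ) : ℂ) * absCpow (s - 2) (a r + b r * Real.cos θ)))]
    · simp
    · intro θ _
      refine ((Real.hasDerivAt_sin θ).ofReal_comp.mul
        ((hasDerivAt_mul_absCpow (h r θ)).scomp θ (huθ θ))).congr_deriv ?_
      rw [Complex.real_smul]
      simp only [Function.comp]
      push_cast
      ring
    · apply Continuous.intervalIntegrable
      fun_prop
  refine ((hb r).ofReal_comp.mul h2).congr_deriv ?_
  -- The multiple of the vanishing integral by which the two sides differ.
  have h5 := congrArg (fun z => -(s * (ε : ℂ)) * z) h4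
  simp only [mul_zero] at h5
  rw [← add_zero (s * (s + 1) * b r * laplace a b s r), ← h5, laplaceDeriv, laplace]
  simp only [← intervalIntegral.integral_const_mul]
  have hcs : Continuous fun θ : ℝ => absCpow s (a r + b r * Real.cos θ) :=
    continuous_iff_continuousAt.2 fun θ =>
      (hasDerivAt_absCpow (h r θ)).continuousAt.comp_of_eq (by fun_prop) rfl
  rw [← intervalIntegral.integral_add, ← intervalIntegral.integral_add]
  · congr 1
    ext θ
    rw [← sq_mul_absCpow_sub_two (h r θ), ← hab r]
    have h6 : (Real.sin θ : ℂ) ^ 2 = 1 - (Real.cos θ : ℂ) ^ 2 := by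
      rw [← Complex.ofReal_pow, Real.sin_sq]
      push_cast
      ring
    rw [h6]
    push_cast
    ring
  all_goals
    apply Continuous.intervalIntegrable
    fun_prop

end Laplace

/-! ### The even solution on the hyperbolic cosine side -/

/-- The coefficient of `l ^ n` in the solution of `(cosh r * y')' = l * cosh r * y` with `y 0 = 1`
and `y' 0 = 0`: the result of applying the integral operator of this problem `n` times to the
constant `1`. -/
noncomputable def evenCoeff : ℕ → ℝ → ℝ
  | 0 => fun _ => 1
  | n + 1 => fun r => ∫ u in (0 : ℝ)..r, (Real.cosh u)⁻¹ *
      ∫ v in (0 : ℝ)..u, Real.cosh v * evenCoeff n v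

/-- The coefficient of `l ^ (n + 1)` in `cosh r * y'`, for the solution `y` with coefficients
`evenCoeff`. -/
noncomputable def fluxCoeff (n : ℕ) (r : ℝ) : ℝ :=
  ∫ v in (0 : ℝ)..r, Real.cosh v * evenCoeff n v

lemma evenCoeff_succ (n : ℕ) (r : ℝ) :
    evenCoeff (n + 1) r = ∫ u in (0 : ℝ)..r, (Real.cosh u)⁻¹ * fluxCoeff n u := rfl

lemma continuous_inv_cosh : Continuous fun u : ℝ => (Real.cosh u)⁻¹ :=
  Real.continuous_cosh.inv₀ fun u => (Real.cosh_pos u).ne'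

lemma hasDerivAt_fluxCoeff_of_continuous {n : ℕ} (h : Continuous (evenCoeff n)) (r : ℝ) :
    HasDerivAt (fluxCoeff n) (Real.cosh r * evenCoeff n r) r :=
  intervalIntegral.integral_hasDerivAt_right
    ((Real.continuous_cosh.mul h).intervalIntegrable _ _)
    ((Real.continuous_cosh.mul h).stronglyMeasurableAtFilter volume (𝓝 r))
    (Real.continuous_cosh.mul h).continuousAt

lemma hasDerivAt_evenCoeff_succ_of_continuous {n : ℕ} (h : Continuous (fluxCoeff n)) (r : ℝ) :
    HasDerivAt (evenCoeff (n + 1)) ((Real.cosh r)⁻¹ * fluxCoeff n r) r :=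
  intervalIntegral.integral_hasDerivAt_right
    ((continuous_inv_cosh.mul h).intervalIntegrable _ _)
    ((continuous_inv_cosh.mul h).stronglyMeasurableAtFilter volume (𝓝 r))
    (continuous_inv_cosh.mul h).continuousAt

lemma continuous_evenCoeff (n : ℕ) : Continuous (evenCoeff n) := by
  induction n with
  | zero => exact continuous_const
  | succ n ih =>
    have h : Continuous (fluxCoeff n) := continuous_iff_continuousAt.2 fun r =>
      (hasDerivAt_fluxCoeff_of_continuous ih r).continuousAt
    exact continuous_iff_continuousAt.2 fun r =>
      (hasDerivAt_evenCoeff_succ_of_continuous h r).continuousAt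

lemma hasDerivAt_fluxCoeff (n : ℕ) (r : ℝ) :
    HasDerivAt (fluxCoeff n) (Real.cosh r * evenCoeff n r) r :=
  hasDerivAt_fluxCoeff_of_continuous (continuous_evenCoeff n) r

lemma continuous_fluxCoeff (n : ℕ) : Continuous (fluxCoeff n) :=
  continuous_iff_continuousAt.2 fun r => (hasDerivAt_fluxCoeff n r).continuousAt

lemma hasDerivAt_evenCoeff_succ (n : ℕ) (r : ℝ) :
    HasDerivAt (evenCoeff (n + 1)) ((Real.cosh r)⁻¹ * fluxCoeff n r) r :=
  hasDerivAt_evenCoeff_succ_of_continuous (continuous_fluxCoeff n) r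

lemma integral_zero_neg (f : ℝ → ℝ) (r : ℝ) :
    ∫ u in (0 : ℝ)..-r, f u = -∫ u in (0 : ℝ)..r, f (-u) := by
  rw [intervalIntegral.integral_comp_neg, neg_zero, intervalIntegral.integral_symm]

lemma evenCoeff_neg (n : ℕ) (r : ℝ) : evenCoeff n (-r) = evenCoeff n r := by
  induction n generalizing r with
  | zero => rfl
  | succ n ih =>
    have h : ∀ u, fluxCoeff n (-u) = -fluxCoeff n u := fun u => by
      rw [fluxCoeff, integral_zero_neg, fluxCoeff]
      simp only [Real.cosh_neg, ih]
    rw [evenCoeff_succ, integral_zero_neg, evenCoeff_succ, ← intervalIntegral.integral_neg]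
    simp only [Real.cosh_neg, h, mul_neg, neg_neg]

lemma abs_fluxCoeff_le_of_bound {R C r : ℝ} {n : ℕ} (hR : |r| ≤ R) (hC : 0 ≤ C)
    (h : ∀ v, |v| ≤ |r| → |evenCoeff n v| ≤ C) :
    |fluxCoeff n r| ≤ R * Real.cosh R * C := by
  have h1 : ‖∫ v in (0 : ℝ)..r, Real.cosh v * evenCoeff n v‖ ≤ Real.cosh R * C * |r - 0| := by
    refine intervalIntegral.norm_integral_le_of_norm_le_const fun v hv => ?_
    have hv' : |v| ≤ |r| := by
      have := abs_sub_left_of_mem_uIcc (uIoc_subset_uIcc hv)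
      simpa using this
    rw [Real.norm_eq_abs, abs_mul, abs_of_pos (Real.cosh_pos v)]
    refine mul_le_mul (Real.cosh_le_cosh.2 ?_) (h v hv') (abs_nonneg _) (Real.cosh_pos _).le
    exact (hv'.trans hR).trans (le_abs_self R)
  rw [sub_zero] at h1
  calc |fluxCoeff n r| ≤ Real.cosh R * C * |r| := h1
    _ ≤ Real.cosh R * C * R := by
      have := mul_nonneg (Real.cosh_pos R).le hC
      gcongr
    _ = R * Real.cosh R * C := by ring

/-- The factorial decay comes from the outer integration; the inner one is bounded crudely by
`R * cosh R` times the supremum of the integrand. -/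
lemma abs_evenCoeff_le {R : ℝ} (n : ℕ) : ∀ r : ℝ, |r| ≤ R →
    |evenCoeff n r| ≤ (R * Real.cosh R * |r|) ^ n / n.factorial := by
  induction n with
  | zero => intro r _; simp [evenCoeff]
  | succ n ih =>
    intro r hr
    have hR : 0 ≤ R := (abs_nonneg r).trans hr
    have hD : 0 ≤ R * Real.cosh R := mul_nonneg hR (Real.cosh_pos R).le
    wlog h0 : 0 ≤ r generalizing r
    · have := this (-r) (by rwa [abs_neg]) (by linarith)
      rwa [evenCoeff_neg, abs_neg] at this
    have hint : ∫ u in (0 : ℝ)..r, R * Real.cosh R * ((R * Real.cosh R * u) ^ n / n.factorial) =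
        (R * Real.cosh R * |r|) ^ (n + 1) / (n + 1).factorial := by
      have : ∀ u : ℝ, R * Real.cosh R * ((R * Real.cosh R * u) ^ n / n.factorial) =
          (R * Real.cosh R) ^ (n + 1) / n.factorial * u ^ n := fun u => by ring
      simp only [this]
      rw [intervalIntegral.integral_const_mul, integral_pow, abs_of_nonneg h0, Nat.factorial_succ]
      have : (n.factorial : ℝ) ≠ 0 := by exact_mod_cast n.factorial_ne_zero
      push_cast
      field_simp
      ring
    rw [← hint, evenCoeff_succ, ← Real.norm_eq_abs]
    refine intervalIntegral.norm_integral_le_of_norm_le h0 ?_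
      (Continuous.intervalIntegrable (by fun_prop) _ _)
    refine Eventually.of_forall fun u hu => ?_
    have hu0 : |u| = u := abs_of_pos hu.1
    rw [Real.norm_eq_abs, abs_mul, abs_of_pos (inv_pos.2 (Real.cosh_pos u))]
    have huR : |u| ≤ R := by rw [hu0]; exact hu.2.trans ((le_abs_self r).trans hr)
    have h2 : |fluxCoeff n u| ≤ R * Real.cosh R * ((R * Real.cosh R * u) ^ n / n.factorial) := by
      refine abs_fluxCoeff_le_of_bound huR ?_ fun v hv => ?_
      · have := hu.1.le
        positivity
      · refine (ih v (hv.trans huR)).trans ?_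
        rw [← hu0]
        gcongr
    calc (Real.cosh u)⁻¹ * |fluxCoeff n u| ≤ 1 * |fluxCoeff n u| := by
          gcongr
          exact inv_le_one_of_one_le₀ (Real.one_le_cosh u)
      _ ≤ _ := by rwa [one_mul]

lemma abs_evenCoeff_le_const {R r : ℝ} (n : ℕ) (hr : |r| ≤ R) :
    |evenCoeff n r| ≤ (R * Real.cosh R * R) ^ n / n.factorial := by
  refine (abs_evenCoeff_le n r hr).trans ?_
  have hR : 0 ≤ R := (abs_nonneg r).trans hr
  have := (Real.cosh_pos R).le
  gcongr

lemma abs_fluxCoeff_le {R r : ℝ} (n : ℕ) (hr : |r| ≤ R) :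
    |fluxCoeff n r| ≤ R * Real.cosh R * ((R * Real.cosh R * R) ^ n / n.factorial) := by
  have hR : 0 ≤ R := (abs_nonneg r).trans hr
  have := (Real.cosh_pos R).le
  exact abs_fluxCoeff_le_of_bound hr (by positivity) fun v hv =>
    abs_evenCoeff_le_const n (hv.trans hr)

/-- The solution of `(cosh r * y')' = l * cosh r * y` with `y 0 = 1` and `y' 0 = 0`. Its constant
term `evenCoeff 0 r = 1` is split off, so that the series can be differentiated termwise. -/
noncomputable def evenSol (l : ℂ) (r : ℝ) : ℂ := 1 + ∑' n : ℕ, l ^ (n + 1) * evenCoeff (n + 1) r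

/-- The function `cosh r * y'` for `y = evenSol l`. The equation is treated as the first order
system `y' = h / cosh r`, `h' = l * cosh r * y`. -/
noncomputable def evenFlux (l : ℂ) (r : ℝ) : ℂ := ∑' n : ℕ, l ^ (n + 1) * fluxCoeff n r

lemma evenSol_zero (l : ℂ) : evenSol l 0 = 1 := by
  simp [evenSol, evenCoeff]

lemma evenFlux_zero (l : ℂ) : evenFlux l 0 = 0 := by
  simp [evenFlux, fluxCoeff]

lemma summable_bound (B C x : ℝ) :
    Summable fun n : ℕ => B ^ (n + 1) * (C * (x ^ n / n.factorial)) := by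
  refine ((Real.summable_pow_div_factorial (B * x)).mul_left (B * C)).congr fun n => ?_
  rw [mul_pow]
  ring

lemma summable_evenSol (l : ℂ) (r : ℝ) : Summable fun n : ℕ => l ^ n * (evenCoeff n r : ℂ) := by
  refine Summable.of_norm_bounded
    (Real.summable_pow_div_factorial (‖l‖ * (|r| * Real.cosh |r| * |r|))) fun n => ?_
  rw [norm_mul, norm_pow, Complex.norm_real, mul_pow, mul_div_assoc]
  gcongr
  exact abs_evenCoeff_le_const n le_rfl

lemma evenSol_eq_tsum (l : ℂ) (r : ℝ) : evenSol l r = ∑' n : ℕ, l ^ n * (evenCoeff n r : ℂ) := by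
  rw [(summable_evenSol l r).tsum_eq_zero_add]
  simp [evenSol, evenCoeff]

lemma isOpen_abs_lt (R : ℝ) : IsOpen {r : ℝ | |r| < R} :=
  isOpen_lt continuous_abs continuous_const

lemma isPreconnected_abs_lt (R : ℝ) : IsPreconnected {r : ℝ | |r| < R} := by
  have : {r : ℝ | |r| < R} = Ioo (-R) R := by
    ext r
    simp [abs_lt]
  rw [this]
  exact isPreconnected_Ioo

lemma hasDerivAt_evenSol (l : ℂ) (r : ℝ) :
    HasDerivAt (evenSol l) (evenFlux l r / Real.cosh r) r := by
  have hR : 0 < |r| + 1 := by positivity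
  have h := hasDerivAt_tsum_of_isPreconnected (𝕜 := ℝ) (t := {x : ℝ | |x| < |r| + 1})
    (g := fun n x => l ^ (n + 1) * (evenCoeff (n + 1) x : ℂ))
    (g' := fun n x => l ^ (n + 1) * (((Real.cosh x)⁻¹ * fluxCoeff n x : ℝ) : ℂ)) (y₀ := 0) (y := r)
    (summable_bound ‖l‖ ((|r| + 1) * Real.cosh (|r| + 1))
      ((|r| + 1) * Real.cosh (|r| + 1) * (|r| + 1))) (isOpen_abs_lt _) (isPreconnected_abs_lt _)
    (fun n x _ => (hasDerivAt_evenCoeff_succ n x).ofReal_comp.const_mul _)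
    (fun n x hx => ?_) (by simpa using hR) (by simp [evenCoeff]) (lt_add_one |r|)
  · refine (h.const_add 1).congr_deriv ?_
    rw [evenFlux, div_eq_mul_inv, ← tsum_mul_right]
    congr 1
    ext n
    push_cast
    ring
  · rw [norm_mul, norm_pow, Complex.norm_real, Real.norm_eq_abs, abs_mul,
      abs_of_pos (inv_pos.2 (Real.cosh_pos x))]
    have h1 : (Real.cosh x)⁻¹ ≤ 1 := inv_le_one_of_one_le₀ (Real.one_le_cosh x)
    have h2 := abs_fluxCoeff_le n (le_of_lt hx)
    refine mul_le_mul_of_nonneg_left ?_ (by positivity)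
    calc (Real.cosh x)⁻¹ * |fluxCoeff n x| ≤ 1 * |fluxCoeff n x| := by gcongr
      _ ≤ _ := by rwa [one_mul]

lemma hasDerivAt_evenFlux (l : ℂ) (r : ℝ) :
    HasDerivAt (evenFlux l) (l * Real.cosh r * evenSol l r) r := by
  have hR : 0 < |r| + 1 := by positivity
  have h := hasDerivAt_tsum_of_isPreconnected (𝕜 := ℝ) (t := {x : ℝ | |x| < |r| + 1})
    (g := fun n x => l ^ (n + 1) * (fluxCoeff n x : ℂ))
    (g' := fun n x => l ^ (n + 1) * ((Real.cosh x * evenCoeff n x : ℝ) : ℂ)) (y₀ := 0) (y := r)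
    (summable_bound ‖l‖ (Real.cosh (|r| + 1))
      ((|r| + 1) * Real.cosh (|r| + 1) * (|r| + 1))) (isOpen_abs_lt _) (isPreconnected_abs_lt _)
    (fun n x _ => (hasDerivAt_fluxCoeff n x).ofReal_comp.const_mul _)
    (fun n x hx => ?_) (by simpa using hR) (by simp [fluxCoeff]) (lt_add_one |r|)
  · refine h.congr_deriv ?_
    rw [evenSol_eq_tsum, ← tsum_mul_left]
    congr 1
    ext n
    push_cast
    ring
  · rw [norm_mul, norm_pow, Complex.norm_real, Real.norm_eq_abs, abs_mul,
      abs_of_pos (Real.cosh_pos x)]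
    have h1 : Real.cosh x ≤ Real.cosh (|r| + 1) :=
      Real.cosh_le_cosh.2 (le_of_lt (lt_of_lt_of_le hx (le_abs_self _)))
    have h2 := abs_evenCoeff_le_const n (le_of_lt hx)
    gcongr

lemma differentiable_evenSol (r : ℝ) : Differentiable ℂ fun l => evenSol l r := by
  intro l
  have h : DifferentiableOn ℂ (fun l : ℂ => ∑' n : ℕ, l ^ n * (evenCoeff n r : ℂ))
      (Metric.ball 0 (‖l‖ + 1)) := by
    refine Complex.differentiableOn_tsum_of_summable_norm
      (Real.summable_pow_div_factorial ((‖l‖ + 1) * (|r| * Real.cosh |r| * |r|)))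
      (fun n => ((differentiable_id.pow n).mul_const _).differentiableOn) Metric.isOpen_ball
      fun n w hw => ?_
    rw [norm_mul, norm_pow, Complex.norm_real, mul_pow, mul_div_assoc]
    have hw : ‖w‖ ≤ ‖l‖ + 1 := (mem_ball_zero_iff.1 hw).le
    gcongr
    exact abs_evenCoeff_le_const n le_rfl
  have h2 := h.differentiableAt (x := l) (Metric.isOpen_ball.mem_nhds (by simp))
  refine h2.congr_of_eventuallyEq (Eventually.of_forall fun l => evenSol_eq_tsum l r)

/-- Uniqueness for the initial value problem, by Grönwall's inequality. -/
lemma eq_zero_of_system {y h : ℝ → ℂ} {l : ℂ}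
    (hy : ∀ r, HasDerivAt y (h r / Real.cosh r) r)
    (hh : ∀ r, HasDerivAt h (l * Real.cosh r * y r) r) (y0 : y 0 = 0) (h0 : h 0 = 0)
    {R : ℝ} (hR : 0 ≤ R) : y R = 0 := by
  have hd : ∀ r, HasDerivAt (fun r => (y r, h r)) (h r / Real.cosh r, l * Real.cosh r * y r) r :=
    fun r => (hy r).prodMk (hh r)
  have := eq_zero_of_abs_deriv_le_mul_abs_self_of_eq_zero_right (a := 0) (b := R)
    (K := 1 + ‖l‖ * Real.cosh R)
    (fun r _ => (hd r).continuousAt.continuousWithinAt) (fun r _ => (hd r).hasDerivWithinAt)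
    (by simp [y0, h0]) (fun r hr => ?_) R ⟨hR, le_rfl⟩
  · exact (Prod.mk.inj this).1
  · have hc : (0 : ℝ) < Real.cosh r := Real.cosh_pos r
    have hc1 : Real.cosh r ≤ Real.cosh R := Real.cosh_le_cosh.2 (by
      rw [abs_of_nonneg hr.1, abs_of_nonneg hR]; exact hr.2.le)
    have hn : 0 ≤ ‖l‖ * Real.cosh R := by positivity
    have e1 : ‖y r‖ ≤ ‖(y r, h r)‖ := norm_fst_le (y r, h r)
    have e2 : ‖h r‖ ≤ ‖(y r, h r)‖ := norm_snd_le (y r, h r)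
    refine max_le ?_ ?_
    · rw [norm_div, Complex.norm_real, Real.norm_eq_abs, abs_of_pos hc]
      calc ‖h r‖ / Real.cosh r ≤ ‖h r‖ := div_le_self (norm_nonneg _) (Real.one_le_cosh r)
        _ ≤ 1 * ‖(y r, h r)‖ := by rwa [one_mul]
        _ ≤ _ := by gcongr; linarith
    · rw [norm_mul, norm_mul, Complex.norm_real, Real.norm_eq_abs, abs_of_pos hc]
      calc ‖l‖ * Real.cosh r * ‖y r‖ ≤ ‖l‖ * Real.cosh R * ‖(y r, h r)‖ := by gcongr
        _ ≤ _ := by gcongr; linarith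

lemma eq_mul_evenSol {y h : ℝ → ℂ} {l : ℂ}
    (hy : ∀ r, HasDerivAt y (h r / Real.cosh r) r)
    (hh : ∀ r, HasDerivAt h (l * Real.cosh r * y r) r) (h0 : h 0 = 0)
    {R : ℝ} (hR : 0 ≤ R) : y R = y 0 * evenSol l R := by
  refine sub_eq_zero.1 (eq_zero_of_system (y := fun r => y r - y 0 * evenSol l r)
    (h := fun r => h r - y 0 * evenFlux l r) (l := l) (fun r => ?_) (fun r => ?_) ?_ ?_ hR)
  · exact ((hy r).sub ((hasDerivAt_evenSol l r).const_mul _)).congr_deriv (by ring)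
  · exact ((hh r).sub ((hasDerivAt_evenFlux l r).const_mul _)).congr_deriv (by ring)
  · simp [evenSol_zero]
  · simp [evenFlux_zero, h0]

/-! ### Zeros of solutions force a real negative spectral parameter -/

lemma deriv_eq_zero_of_nonneg_of_eq_endpoints {N N' : ℝ → ℝ} {a b : ℝ}
    (hc : ContinuousOn N (Icc a b)) (hd : ∀ r ∈ Ioo a b, HasDerivAt N (N' r) r)
    (hn : ∀ r ∈ Ioo a b, 0 ≤ N' r) (h : N a = N b) {r : ℝ} (hr : r ∈ Ioo a b) : N' r = 0 := by
  have hm : MonotoneOn N (Icc a b) := by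
    refine monotoneOn_of_deriv_nonneg (convex_Icc a b) hc ?_ ?_
    · rw [interior_Icc]
      exact fun r hr => (hd r hr).differentiableAt.differentiableWithinAt
    · rw [interior_Icc]
      intro r hr
      rw [(hd r hr).deriv]
      exact hn r hr
  have hab : a ≤ b := (hr.1.trans hr.2).le
  have hconst : N =ᶠ[𝓝 r] fun _ => N a := by
    filter_upwards [Ioo_mem_nhds hr.1 hr.2] with x hx
    have hx' : x ∈ Icc a b := Ioo_subset_Icc_self hx
    exact le_antisymm ((hm hx' ⟨hab, le_rfl⟩ hx'.2).trans_eq h.symm)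
      (hm ⟨le_rfl, hab⟩ hx' hx'.1)
  exact (hd r hr).unique ((hasDerivAt_const r (N a)).congr_of_eventuallyEq hconst)

lemma hasDerivAt_re {y : ℝ → ℂ} {y' : ℂ} {r : ℝ} (h : HasDerivAt y y' r) :
    HasDerivAt (fun r => (y r).re) y'.re r :=
  (Complex.reCLM.hasFDerivAt (x := y r)).comp_hasDerivAt r h

lemma hasDerivAt_im {y : ℝ → ℂ} {y' : ℂ} {r : ℝ} (h : HasDerivAt y y' r) :
    HasDerivAt (fun r => (y r).im) y'.im r :=
  (Complex.imCLM.hasFDerivAt (x := y r)).comp_hasDerivAt r h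

lemma eq_zero_of_eq_zero_on_Ioo {y : ℝ → ℂ} {R : ℝ} (hR : 0 < R)
    (hy : ContinuousOn y (Icc 0 R)) (h : ∀ r ∈ Ioo 0 R, y r = 0) : y 0 = 0 := by
  have h1 : Tendsto y (𝓝[Ioo 0 R] 0) (𝓝 (y 0)) :=
    (hy 0 ⟨le_rfl, hR.le⟩).mono_left (nhdsWithin_mono _ Ioo_subset_Icc_self)
  have : (𝓝[Ioo 0 R] (0 : ℝ)).NeBot := left_nhdsWithin_Ioo_neBot hR
  refine tendsto_nhds_unique h1 (tendsto_const_nhds.congr' ?_)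
  filter_upwards [self_mem_nhdsWithin] with r hr using (h r hr).symm

section

variable {p : ℝ → ℝ} {y h : ℝ → ℂ} {l : ℂ} {R : ℝ}

/-- For `p y' = h`, `h' = l p y`, the function `Im (h * conj y)` has derivative `Im l * p * |y|²`,
and it vanishes at both ends of `[0, R]`. Multiplication by `Im l` makes the derivative
nonnegative, and hence zero. Neither `y'` nor `1 / p` is needed at `0`, so that `p 0 = 0` is
allowed. -/
lemma im_eq_zero_of_zero (hR : 0 < R) (hp : ∀ r ∈ Ioo 0 R, 0 < p r)
    (hy : ∀ r ∈ Ioo 0 R, HasDerivAt y (h r / p r) r)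
    (hh : ∀ r ∈ Ioo 0 R, HasDerivAt h (l * p r * y r) r)
    (cy : ContinuousOn y (Icc 0 R)) (ch : ContinuousOn h (Icc 0 R))
    (h0 : h 0 = 0) (y0 : y 0 ≠ 0) (yR : y R = 0) : l.im = 0 := by
  by_contra hl
  refine y0 (eq_zero_of_eq_zero_on_Ioo hR cy fun r hr => ?_)
  have hyre : ContinuousOn (fun r => (y r).re) (Icc 0 R) :=
    Complex.continuous_re.comp_continuousOn cy
  have hyim : ContinuousOn (fun r => (y r).im) (Icc 0 R) :=
    Complex.continuous_im.comp_continuousOn cy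
  have hhre : ContinuousOn (fun r => (h r).re) (Icc 0 R) :=
    Complex.continuous_re.comp_continuousOn ch
  have hhim : ContinuousOn (fun r => (h r).im) (Icc 0 R) :=
    Complex.continuous_im.comp_continuousOn ch
  have key := deriv_eq_zero_of_nonneg_of_eq_endpoints (a := 0) (b := R)
    (N := fun r => ((h r).im * (y r).re - (h r).re * (y r).im) * l.im)
    (N' := fun r => p r * l.im ^ 2 * Complex.normSq (y r))
    (by fun_prop) (fun r hr => ?_) (fun r hr => ?_) (by simp [h0, yR]) hr
  · have h1 := (hp r hr).ne'
    simpa [h1, hl] using key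
  · have h1 := (hp r hr).ne'
    refine ((((hasDerivAt_im (hh r hr)).mul (hasDerivAt_re (hy r hr))).sub
      ((hasDerivAt_re (hh r hr)).mul (hasDerivAt_im (hy r hr)))).mul_const l.im).congr_deriv ?_
    simp only [Complex.div_ofReal_re, Complex.div_ofReal_im, Complex.mul_re, Complex.mul_im,
      Complex.ofReal_re, Complex.ofReal_im, Complex.normSq_apply]
    ring
  · have h1 := (hp r hr).le
    have h2 := Complex.normSq_nonneg (y r)
    positivity

/-- A Hardy-type refinement for `p = cosh`: if `l` is real and at least `-1 / 4`, then
`Re (h * conj y) + sinh r * |y|² / 2` is nondecreasing on `[0, R]` and vanishes at both ends,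
which forces `y = 0`. -/
lemma re_lt_of_zero_cosh (hR : 0 < R)
    (hy : ∀ r, HasDerivAt y (h r / Real.cosh r) r)
    (hh : ∀ r, HasDerivAt h (l * Real.cosh r * y r) r)
    (h0 : h 0 = 0) (y0 : y 0 ≠ 0) (yR : y R = 0) : l.im = 0 ∧ l.re < -1 / 4 := by
  have cy : ContinuousOn y (Icc 0 R) := fun r _ => (hy r).continuousAt.continuousWithinAt
  have ch : ContinuousOn h (Icc 0 R) := fun r _ => (hh r).continuousAt.continuousWithinAt
  have him : l.im = 0 := im_eq_zero_of_zero hR (fun r _ => Real.cosh_pos r) (fun r _ => hy r)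
    (fun r _ => hh r) cy ch h0 y0 yR
  refine ⟨him, ?_⟩
  by_contra! hl
  have hyre : ContinuousOn (fun r => (y r).re) (Icc 0 R) :=
    Complex.continuous_re.comp_continuousOn cy
  have hyim : ContinuousOn (fun r => (y r).im) (Icc 0 R) :=
    Complex.continuous_im.comp_continuousOn cy
  have hhre : ContinuousOn (fun r => (h r).re) (Icc 0 R) :=
    Complex.continuous_re.comp_continuousOn ch
  have hhim : ContinuousOn (fun r => (h r).im) (Icc 0 R) :=
    Complex.continuous_im.comp_continuousOn ch
  -- `Q` bounds the modulus of the real part of `y' * conj y` by the arithmetic-geometric mean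
  let Q : ℝ → ℝ := fun r => ((h r).re / Real.cosh r) ^ 2 + ((h r).im / Real.cosh r) ^ 2 +
    1 / 4 * ((y r).re ^ 2 + (y r).im ^ 2)
  let T' : ℝ → ℝ := fun r =>
    Real.cosh r * (((h r).re / Real.cosh r) ^ 2 + ((h r).im / Real.cosh r) ^ 2 +
      (l.re + 1 / 2) * ((y r).re ^ 2 + (y r).im ^ 2)) +
    Real.sinh r * ((h r).re / Real.cosh r * (y r).re + (h r).im / Real.cosh r * (y r).im)
  have hT' : ∀ r ∈ Ioo 0 R, (Real.cosh r - Real.sinh r) * Q r ≤ T' r := by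
    intro r hr
    have hc := Real.cosh_pos r
    have hs : 0 < Real.sinh r := Real.sinh_pos_iff.2 hr.1
    simp only [Q, T']
    set a := (h r).re / Real.cosh r
    set b := (h r).im / Real.cosh r
    set c := (y r).re
    set d := (y r).im
    have e1 : 0 ≤ Real.sinh r * ((a + c / 2) ^ 2 + (b + d / 2) ^ 2) := by positivity
    have e2 : 0 ≤ Real.cosh r * ((l.re + 1 / 4) * (c ^ 2 + d ^ 2)) := by
      have : 0 ≤ l.re + 1 / 4 := by linarith
      positivity
    nlinarith
  have hQ : ∀ r, 0 ≤ Q r := fun r => by positivity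
  have hsc : ∀ r, 0 < Real.cosh r - Real.sinh r := fun r => by
    rw [Real.cosh_sub_sinh]; positivity
  refine y0 (eq_zero_of_eq_zero_on_Ioo hR cy fun r hr => ?_)
  have key := deriv_eq_zero_of_nonneg_of_eq_endpoints (a := 0) (b := R)
    (N := fun r => ((h r).re * (y r).re + (h r).im * (y r).im) +
      1 / 2 * (Real.sinh r * ((y r).re ^ 2 + (y r).im ^ 2)))
    (N' := T') ?_ (fun r hr => ?_) (fun r hr => ?_) (by simp [h0, yR]) hr
  · have h1 := hT' r hr
    rw [key] at h1
    have h2 : Q r ≤ 0 := by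
      by_contra! h3
      exact absurd h1 (not_le.2 (mul_pos (hsc r) h3))
    simp only [Q] at h2
    have e1 := sq_nonneg ((h r).re / Real.cosh r)
    have e2 := sq_nonneg ((h r).im / Real.cosh r)
    apply Complex.ext
    · simp only [Complex.zero_re]; nlinarith [sq_nonneg (y r).re, sq_nonneg (y r).im]
    · simp only [Complex.zero_im]; nlinarith [sq_nonneg (y r).re, sq_nonneg (y r).im]
  · have := Real.continuous_sinh.continuousOn (s := Icc 0 R)
    fun_prop
  · have h1 := (Real.cosh_pos r).ne'
    have dyre := (hasDerivAt_re (hy r))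
    have dyim := (hasDerivAt_im (hy r))
    have dhre := (hasDerivAt_re (hh r))
    have dhim := (hasDerivAt_im (hh r))
    refine (((dhre.mul dyre).add (dhim.mul dyim)).add
      (((Real.hasDerivAt_sinh r).mul ((dyre.pow 2).add (dyim.pow 2))).const_mul _)).congr_deriv ?_
    simp only [Complex.div_ofReal_re, Complex.div_ofReal_im, Complex.mul_re, Complex.mul_im,
      Complex.ofReal_re, Complex.ofReal_im, him, T']
    simp
    field_simp
    ring
  · exact (mul_nonneg (hsc r).le (hQ r)).trans (hT' r hr)

end

/-! ### The integral of a complex power of the cosine -/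

lemma measurable_absCpow (s : ℂ) : Measurable (absCpow s) := by
  unfold absCpow
  fun_prop

lemma image_cos_sq_Ioo : (fun x : ℝ => Real.cos x ^ 2) '' Ioo 0 (π / 2) = Ioo 0 1 := by
  ext t
  constructor
  · rintro ⟨x, hx, rfl⟩
    have hc : 0 < Real.cos x := Real.cos_pos_of_mem_Ioo ⟨by linarith [hx.1, Real.pi_pos], hx.2⟩
    have hs : 0 < Real.sin x := Real.sin_pos_of_mem_Ioo ⟨hx.1, by linarith [hx.2, Real.pi_pos]⟩
    have := Real.sin_sq_add_cos_sq x
    exact ⟨by positivity, by nlinarith⟩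
  · rintro ⟨h0, h1⟩
    have hs0 : 0 < √t := Real.sqrt_pos.2 h0
    have hs1 : √t < 1 := by rw [Real.sqrt_lt' one_pos]; simpa using h1
    refine ⟨Real.arccos √t, ⟨Real.arccos_pos.2 hs1, Real.arccos_lt_pi_div_two.2 hs0⟩, ?_⟩
    simp only
    rw [Real.cos_arccos (by linarith) hs1.le, Real.sq_sqrt h0.le]

lemma injOn_cos_sq_Ioo : InjOn (fun x : ℝ => Real.cos x ^ 2) (Ioo 0 (π / 2)) := by
  intro x hx y hy hxy
  have hcx : 0 < Real.cos x := Real.cos_pos_of_mem_Ioo ⟨by linarith [hx.1, Real.pi_pos], hx.2⟩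
  have hcy : 0 < Real.cos y := Real.cos_pos_of_mem_Ioo ⟨by linarith [hy.1, Real.pi_pos], hy.2⟩
  have h := (sq_eq_sq₀ hcx.le hcy.le).1 hxy
  exact Real.injOn_cos ⟨hx.1.le, by linarith [hx.2, Real.pi_pos]⟩
    ⟨hy.1.le, by linarith [hy.2, Real.pi_pos]⟩ h

/-- The integrand of the Beta integral `B((s + 1) / 2, 1 / 2)` after the substitution
`t = cos² x`, with the Jacobian included. -/
lemma betaIntegrand_cos_sq (s : ℂ) {x : ℝ} (hx : x ∈ Ioo 0 (π / 2)) :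
    |-(2 * Real.cos x * Real.sin x)| • (((Real.cos x ^ 2 : ℝ) : ℂ) ^ ((s + 1) / 2 - 1) *
      (1 - ((Real.cos x ^ 2 : ℝ) : ℂ)) ^ ((1 : ℂ) / 2 - 1)) = 2 * absCpow s (Real.cos x) := by
  have hc : 0 < Real.cos x := Real.cos_pos_of_mem_Ioo ⟨by linarith [hx.1, Real.pi_pos], hx.2⟩
  have hs : 0 < Real.sin x := Real.sin_pos_of_mem_Ioo ⟨hx.1, by linarith [hx.2, Real.pi_pos]⟩
  have hcc : ((Real.cos x : ℝ) : ℂ) ≠ 0 := by exact_mod_cast hc.ne'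
  have hsc : ((Real.sin x : ℝ) : ℂ) ≠ 0 := by exact_mod_cast hs.ne'
  have h1 : (1 - ((Real.cos x ^ 2 : ℝ) : ℂ)) = ((Real.sin x * Real.sin x : ℝ) : ℂ) := by
    rw [← Complex.ofReal_one, ← Complex.ofReal_sub, ← Real.sin_sq, sq]
  rw [h1, sq, Complex.ofReal_mul, Complex.ofReal_mul,
    Complex.mul_cpow_ofReal_nonneg hc.le hc.le, Complex.mul_cpow_ofReal_nonneg hs.le hs.le,
    ← Complex.cpow_add _ _ hcc, ← Complex.cpow_add _ _ hsc, abs_neg, abs_of_pos (by positivity),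
    Complex.real_smul, absCpow, abs_of_pos hc]
  have e1 : (s + 1) / 2 - 1 + ((s + 1) / 2 - 1) = s - 1 := by ring
  have e2 : (1 : ℂ) / 2 - 1 + (1 / 2 - 1) = -1 := by norm_num
  rw [e1, e2, Complex.cpow_neg_one, Complex.cpow_sub _ _ hcc, Complex.cpow_one]
  push_cast at hcc hsc ⊢
  field_simp

lemma hasDerivAt_cos_sq (x : ℝ) :
    HasDerivAt (fun x : ℝ => Real.cos x ^ 2) (-(2 * Real.cos x * Real.sin x)) x :=
  ((Real.hasDerivAt_cos x).pow 2).congr_deriv (by simp)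

lemma intervalIntegrable_absCpow_cos_half {s : ℂ} (hs : -1 < s.re) :
    IntervalIntegrable (fun x => absCpow s (Real.cos x)) volume 0 (π / 2) := by
  have hb := Complex.betaIntegral_convergent (u := (s + 1) / 2) (v := 1 / 2)
    (by simp; linarith) (by simp)
  rw [intervalIntegrable_iff_integrableOn_Ioo_of_le zero_le_one, ← image_cos_sq_Ioo,
    integrableOn_image_iff_integrableOn_abs_deriv_smul measurableSet_Ioo
      (fun x _ => (hasDerivAt_cos_sq x).hasDerivWithinAt) injOn_cos_sq_Ioo] at hb
  rw [intervalIntegrable_iff_integrableOn_Ioo_of_le (by positivity)]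
  have h2 := (integrableOn_congr_fun (fun x hx => betaIntegrand_cos_sq s hx) measurableSet_Ioo).1 hb
  simpa [IntegrableOn, integrable_const_mul_iff] using h2

lemma integral_absCpow_cos_half (s : ℂ) :
    2 * ∫ x in (0 : ℝ)..π / 2, absCpow s (Real.cos x) =
      Complex.betaIntegral ((s + 1) / 2) (1 / 2) := by
  rw [Complex.betaIntegral, intervalIntegral.integral_of_le zero_le_one,
    integral_Ioc_eq_integral_Ioo, ← image_cos_sq_Ioo,
    integral_image_eq_integral_abs_deriv_smul measurableSet_Ioo
      (fun x _ => (hasDerivAt_cos_sq x).hasDerivWithinAt) injOn_cos_sq_Ioo,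
    setIntegral_congr_fun measurableSet_Ioo (fun x hx => betaIntegrand_cos_sq s hx),
    integral_const_mul, intervalIntegral.integral_of_le (by positivity),
    integral_Ioc_eq_integral_Ioo]

lemma periodic_absCpow_cos (s : ℂ) : Function.Periodic (fun x => absCpow s (Real.cos x)) π := by
  intro x
  simp only [Real.cos_add_pi, absCpow_neg]

lemma intervalIntegrable_absCpow_cos {s : ℂ} (hs : -1 < s.re) (a b : ℝ) :
    IntervalIntegrable (fun x => absCpow s (Real.cos x)) volume a b := by
  have h1 := intervalIntegrable_absCpow_cos_half hs
  have h2 : IntervalIntegrable (fun x => absCpow s (Real.cos x)) volume (π / 2) π := by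
    have := (h1.comp_sub_left π).symm
    simp only [Real.cos_pi_sub, absCpow_neg] at this
    convert! this using 1 <;> ring
  exact (periodic_absCpow_cos s).intervalIntegrable₀ Real.pi_ne_zero (h1.trans h2) a b

lemma integral_absCpow_cos_pi {s : ℂ} (hs : -1 < s.re) :
    ∫ x in (0 : ℝ)..π, absCpow s (Real.cos x) = Complex.betaIntegral ((s + 1) / 2) (1 / 2) := by
  have h1 := intervalIntegral.integral_comp_sub_left
    (fun x => absCpow s (Real.cos x)) (a := 0) (b := π / 2) π
  simp only [Real.cos_pi_sub, absCpow_neg] at h1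
  rw [sub_zero, sub_half] at h1
  rw [← integral_absCpow_cos_half, ← intervalIntegral.integral_add_adjacent_intervals
    (intervalIntegrable_absCpow_cos hs 0 (π / 2)) (intervalIntegrable_absCpow_cos hs (π / 2) π),
    ← h1]
  ring

lemma integral_absCpow_cos_two_pi {s : ℂ} (hs : -1 < s.re) :
    ∫ x in (0 : ℝ)..2 * π, absCpow s (Real.cos x) =
      2 * Complex.betaIntegral ((s + 1) / 2) (1 / 2) := by
  have h := (periodic_absCpow_cos s).intervalIntegral_add_eq π 0
  rw [zero_add, ← two_mul] at h
  rw [← intervalIntegral.integral_add_adjacent_intervals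
    (intervalIntegrable_absCpow_cos hs 0 π) (intervalIntegrable_absCpow_cos hs π (2 * π)),
    h, integral_absCpow_cos_pi hs]
  ring

/-! ### The period integral -/

/-- The integral `∫ |k + 2 cos θ| ^ s dθ` over a period, equal to `2 π W₁(k; s)` where it
converges. -/
noncomputable def periodIntegral (k : ℝ) (s : ℂ) : ℂ :=
  ∫ θ in (0 : ℝ)..2 * π, absCpow s (k + 2 * Real.cos θ)

lemma absCpow_two_mul (s : ℂ) (u : ℝ) : absCpow (2 * s) u = absCpow s u ^ 2 := by
  have := Complex.cpow_nat_mul ((|u| : ℝ) : ℂ) 2 s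
  simpa [absCpow] using this

lemma ofReal_add_two_mul_cos_ne_zero {k : ℝ} (hk : 2 < |k|) (θ : ℝ) : k + 2 * Real.cos θ ≠ 0 := by
  intro h
  have h1 : |k| = 2 * |Real.cos θ| := by
    rw [eq_neg_of_add_eq_zero_left h, abs_neg, abs_mul, abs_two]
  have := Real.abs_cos_le_one θ
  linarith

lemma intervalIntegrable_absCpow_of_two_lt {k : ℝ} (hk : 2 < |k|) (s : ℂ) :
    IntervalIntegrable (fun θ => absCpow s (k + 2 * Real.cos θ)) volume 0 (2 * π) := by
  refine Continuous.intervalIntegrable (continuous_iff_continuousAt.2 fun θ => ?_) _ _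
  exact (hasDerivAt_absCpow_of_ne s (ofReal_add_two_mul_cos_ne_zero hk θ)).continuousAt.comp_of_eq
    (by fun_prop) rfl

lemma intervalIntegrable_absCpow_comp_half {s : ℂ} (hs : -1 < s.re) (c : ℝ) :
    IntervalIntegrable (fun θ => absCpow s (Real.cos ((θ + c) / 2))) volume 0 (2 * π) := by
  have h := (intervalIntegrable_absCpow_cos hs (c / 2) ((2 * π + c) / 2)).comp_mul_right
    (c := 1 / 2)
  have h2 := h.comp_add_right c
  convert! h2 using 1
  · ext θ; congr 2; ring
  · ring
  · ring

/-- With `k = 2 cos φ` the base is `4 cos ((θ + φ) / 2) cos ((θ - φ) / 2)`. The inequality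
`2 x y ≤ x² + y²` separates the two factors, which become `|cos| ^ (2 s)` with `-1 < Re (2 s)`;
this also covers `|k| = 2`, where the two singularities collide. -/
lemma intervalIntegrable_absCpow_of_le_two {k : ℝ} (hk : |k| ≤ 2) {s : ℂ} (hs : -1 / 2 < s.re) :
    IntervalIntegrable (fun θ => absCpow s (k + 2 * Real.cos θ)) volume 0 (2 * π) := by
  obtain ⟨φ, rfl⟩ : ∃ φ, k = 2 * Real.cos φ := by
    refine ⟨Real.arccos (k / 2), ?_⟩
    rw [Real.cos_arccos] <;> linarith [abs_le.1 hk]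
  have hs2 : -1 < (2 * s).re := by
    simp
    linarith
  have h1 := (intervalIntegrable_absCpow_comp_half hs2 φ).norm
  have h2 := (intervalIntegrable_absCpow_comp_half hs2 (-φ)).norm
  refine ((h1.add h2).const_mul ‖absCpow s 4‖).mono_fun ?_ ?_
  · exact ((measurable_absCpow s).comp (by fun_prop)).aestronglyMeasurable
  · refine Eventually.of_forall fun θ => ?_
    have e : 2 * Real.cos φ + 2 * Real.cos θ =
        4 * (Real.cos ((θ + φ) / 2) * Real.cos ((θ + -φ) / 2)) := by
      have h := Real.cos_add_cos θ φ
      rw [sub_eq_add_neg] at h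
      linarith
    simp only [e, absCpow_mul, absCpow_two_mul, norm_mul, norm_pow, norm_norm]
    gcongr
    rw [Real.norm_eq_abs, abs_of_nonneg (by positivity)]
    nlinarith [sq_nonneg (‖absCpow s (Real.cos ((θ + φ) / 2))‖ -
      ‖absCpow s (Real.cos ((θ + -φ) / 2))‖), sq_nonneg ‖absCpow s (Real.cos ((θ + φ) / 2))‖,
      sq_nonneg ‖absCpow s (Real.cos ((θ + -φ) / 2))‖]

lemma intervalIntegrable_absCpow {k : ℝ} {s : ℂ} (h : 2 < |k| ∨ -1 / 2 < s.re) :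
    IntervalIntegrable (fun θ => absCpow s (k + 2 * Real.cos θ)) volume 0 (2 * π) := by
  rcases lt_or_ge 2 |k| with hk | hk
  · exact intervalIntegrable_absCpow_of_two_lt hk s
  · exact intervalIntegrable_absCpow_of_le_two hk (h.resolve_left hk.not_gt)

lemma ae_ne_zero (k : ℝ) : ∀ᵐ θ : ℝ, k + 2 * Real.cos θ ≠ 0 := by
  by_cases h : ∃ φ, k + 2 * Real.cos φ = 0
  · obtain ⟨φ, hφ⟩ := h
    have hc : (range (fun n : ℤ => 2 * (n : ℝ) * π + φ) ∪
        range (fun n : ℤ => 2 * (n : ℝ) * π - φ)).Countable :=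
      (countable_range _).union (countable_range _)
    filter_upwards [hc.ae_notMem volume] with θ hθ h0
    obtain ⟨n, hn⟩ := Real.cos_eq_cos_iff.1 (show Real.cos φ = Real.cos θ by linarith)
    refine hθ (hn.imp (fun h => ⟨n, h.symm⟩) fun h => ⟨n, h.symm⟩)
  · push Not at h
    exact Eventually.of_forall h

lemma mem_integrableExpSet {k t : ℝ} (h : 2 < |k| ∨ -1 / 2 < t) :
    t ∈ ProbabilityTheory.integrableExpSet (fun θ => Real.log (k + 2 * Real.cos θ))
      (volume.restrict (Ioc 0 (2 * π))) := by
  have h1 := (intervalIntegrable_absCpow (s := (t : ℂ)) (k := k) (by simpa using h)).norm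
  rw [intervalIntegrable_iff_integrableOn_Ioc_of_le (by positivity)] at h1
  refine h1.congr ?_
  filter_upwards [ae_restrict_of_ae (ae_ne_zero k)] with θ hθ
  rw [absCpow_of_ne _ hθ, ← Complex.ofReal_mul, Complex.norm_exp_ofReal]

/-- The period integral is the complex moment generating function of `log |k + 2 cos θ|`
(`Real.log` ignores the sign of its argument), which gives its analyticity in `s`. -/
lemma periodIntegral_eq_complexMGF (k : ℝ) :
    periodIntegral k = ProbabilityTheory.complexMGF
      (fun θ => Real.log (k + 2 * Real.cos θ)) (volume.restrict (Ioc 0 (2 * π))) := by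
  ext s
  rw [periodIntegral, intervalIntegral.integral_of_le (by positivity), ProbabilityTheory.complexMGF]
  refine integral_congr_ae ?_
  filter_upwards [ae_restrict_of_ae (ae_ne_zero k)] with θ hθ
  rw [absCpow_of_ne _ hθ]

lemma analyticAt_periodIntegral {k : ℝ} {s : ℂ} (h : 2 < |k| ∨ -1 / 2 < s.re) :
    AnalyticAt ℂ (periodIntegral k) s := by
  rw [periodIntegral_eq_complexMGF]
  refine ProbabilityTheory.analyticAt_complexMGF (mem_interior_iff_mem_nhds.2 ?_)
  rcases h with hk | hs
  · exact Filter.mem_of_superset univ_mem fun t _ => mem_integrableExpSet (Or.inl hk)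
  · filter_upwards [Ioi_mem_nhds hs] with t ht using mem_integrableExpSet (Or.inr ht)

lemma periodIntegral_neg (k : ℝ) (s : ℂ) : periodIntegral (-k) s = periodIntegral k s := by
  have hp : Function.Periodic (fun θ => absCpow s (-k + 2 * Real.cos θ)) (2 * π) := fun θ => by
    simp only [Real.cos_add_two_pi]
  have h := hp.intervalIntegral_add_eq 0 π
  rw [zero_add] at h
  rw [periodIntegral, h, add_comm π, periodIntegral]
  have h2 := intervalIntegral.integral_comp_add_right
    (fun θ => absCpow s (-k + 2 * Real.cos θ)) (a := 0) (b := 2 * π) π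
  rw [zero_add] at h2
  rw [← h2]
  congr 1
  ext θ
  rw [← absCpow_neg, Real.cos_add_pi]
  congr 1
  ring

lemma periodIntegral_abs (k : ℝ) (s : ℂ) : periodIntegral |k| s = periodIntegral k s := by
  rcases abs_choice k with h | h <;> rw [h]
  exact periodIntegral_neg k s

lemma periodIntegral_two {s : ℂ} (hs : -1 / 2 < s.re) :
    periodIntegral 2 s = absCpow s 4 * (2 * Complex.betaIntegral (s + 1 / 2) (1 / 2)) := by
  have hs2 : -1 < (2 * s).re := by
    simp
    linarith
  have h1 := integral_absCpow_cos_pi hs2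
  have e : (2 * s + 1) / 2 = s + 1 / 2 := by ring
  rw [e] at h1
  have h2 := intervalIntegral.integral_comp_div (fun x => absCpow (2 * s) (Real.cos x))
    (a := 0) (b := 2 * π) (c := 2) two_ne_zero
  rw [zero_div, mul_div_cancel_left₀ _ (two_ne_zero), h1] at h2
  have h3 : ∀ θ : ℝ, absCpow s (2 + 2 * Real.cos θ) =
      absCpow s 4 * absCpow (2 * s) (Real.cos (θ / 2)) := fun θ => by
    have e : 2 + 2 * Real.cos θ = 4 * (Real.cos (θ / 2) * Real.cos (θ / 2)) := by
      have := Real.cos_sq (θ / 2)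
      rw [mul_div_cancel₀ _ (two_ne_zero)] at this
      linarith
    rw [e, absCpow_mul, absCpow_mul, absCpow_two_mul, sq]
  rw [periodIntegral]
  simp only [h3]
  rw [intervalIntegral.integral_const_mul, h2, Complex.real_smul]
  norm_num

/-! ### The circle integral as a period integral -/

lemma zmfIntegrand_circleMap (k : ℝ) (s : ℂ) (θ : ℝ) :
    zmfIntegrand k s (circleMap 0 1 θ) =
      absCpow s (k + 2 * Real.cos θ) * Complex.exp (-(θ * Complex.I)) := by
  have h : (k : ℂ) + (Complex.exp (θ * Complex.I) + (Complex.exp (θ * Complex.I))⁻¹) =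
      ((k + 2 * Real.cos θ : ℝ) : ℂ) := by
    rw [← Complex.exp_neg]
    push_cast
    rw [Complex.cos]
    ring_nf
  simp only [zmfIntegrand, circleMap, Complex.ofReal_one, one_mul, zero_add]
  rw [h, Complex.norm_real, Real.norm_eq_abs, ← Complex.exp_neg, absCpow]

lemma zmfIntegral_eq (k : ℝ) (s : ℂ) :
    zmfIntegral k s = (2 * (π : ℂ))⁻¹ * periodIntegral k s := by
  rw [zmfIntegral, circleIntegral, periodIntegral]
  have h : ∀ θ : ℝ, deriv (circleMap 0 1) θ • zmfIntegrand k s (circleMap 0 1 θ) =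
      Complex.I * absCpow s (k + 2 * Real.cos θ) := fun θ => by
    rw [zmfIntegrand_circleMap, deriv_circleMap, smul_eq_mul, Complex.exp_neg]
    simp only [circleMap, Complex.ofReal_one, one_mul, zero_add]
    have := Complex.exp_ne_zero (θ * Complex.I)
    field_simp
  simp only [h]
  rw [intervalIntegral.integral_const_mul]
  have : (π : ℂ) ≠ 0 := by exact_mod_cast Real.pi_ne_zero
  field_simp

lemma circleIntegrable_zmfIntegrand (k : ℝ) {s : ℂ} (hs : -1 / 2 < s.re) :
    CircleIntegrable (zmfIntegrand k s) 0 1 := by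
  rw [CircleIntegrable]
  simp only [zmfIntegrand_circleMap]
  exact (intervalIntegrable_absCpow (Or.inr hs)).mul_continuousOn (by fun_prop)

/-! ### The period integral for `|k| < 2` -/

lemma periodIntegral_two_mul_div {a b : ℝ → ℝ} {r : ℝ} (hb : b r ≠ 0) (s : ℂ) :
    periodIntegral (2 * (a r / b r)) s = absCpow s (2 / b r) * laplace a b s r := by
  rw [periodIntegral, laplace, ← intervalIntegral.integral_const_mul]
  congr 1
  ext θ
  rw [← absCpow_mul]
  congr 1
  field_simp

/-- The integrand changes sign under `θ ↦ θ + π`. -/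
lemma laplaceDeriv_sinh_cosh_zero (s : ℂ) : laplaceDeriv Real.sinh Real.cosh s 0 = 0 := by
  have e : ∀ θ : ℝ, s * (((Real.sinh 0 + Real.cosh 0 * Real.cos θ : ℝ) : ℂ) *
      absCpow (s - 2) (Real.sinh 0 + Real.cosh 0 * Real.cos θ)) *
      ((Real.cosh 0 + Real.sinh 0 * Real.cos θ : ℝ) : ℂ) =
      s * ((Real.cos θ : ℝ) * absCpow (s - 2) (Real.cos θ)) := fun θ => by simp
  rw [laplaceDeriv]
  simp only [e]
  have hp : Function.Periodic (fun θ : ℝ => s * (((Real.cos θ : ℝ) : ℂ) *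
      absCpow (s - 2) (Real.cos θ))) (2 * π) := fun θ => by simp only [Real.cos_add_two_pi]
  have h := hp.intervalIntegral_add_eq 0 π
  have h2 := intervalIntegral.integral_comp_add_right
    (fun θ : ℝ => s * (((Real.cos θ : ℝ) : ℂ) * absCpow (s - 2) (Real.cos θ)))
    (a := 0) (b := 2 * π) π
  rw [zero_add] at h h2
  rw [add_comm (2 * π), ← h] at h2
  simp only [Real.cos_add_pi, absCpow_neg, Complex.ofReal_neg, neg_mul, mul_neg,
    intervalIntegral.integral_neg] at h2
  exact self_eq_neg.1 h2.symm

lemma laplace_sinh_cosh_zero {s : ℂ} (hs : -1 < s.re) :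
    laplace Real.sinh Real.cosh s 0 = 2 * Complex.betaIntegral ((s + 1) / 2) (1 / 2) := by
  rw [← integral_absCpow_cos_two_pi hs, laplace]
  simp

lemma laplace_sinh_cosh {s : ℂ} (hs : 2 < s.re) {r : ℝ} (hr : 0 ≤ r) :
    laplace Real.sinh Real.cosh s r =
      2 * Complex.betaIntegral ((s + 1) / 2) (1 / 2) * evenSol (s * (s + 1)) r := by
  rw [← laplace_sinh_cosh_zero (by linarith)]
  refine eq_mul_evenSol (h := fun r => (Real.cosh r : ℂ) * laplaceDeriv Real.sinh Real.cosh s r)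
    (fun r => ?_) (fun r => ?_) ?_ hr
  · refine (hasDerivAt_laplace Real.hasDerivAt_sinh Real.hasDerivAt_cosh
      (fun _ _ => Or.inr hs) r).congr_deriv ?_
    rw [mul_div_cancel_left₀]
    exact_mod_cast (Real.cosh_pos r).ne'
  · exact hasDerivAt_mul_laplaceDeriv (ε := 1) Real.hasDerivAt_sinh Real.hasDerivAt_cosh
      (fun r => by rw [Real.cosh_sq]; ring) (fun _ _ => Or.inr hs) r
  · simp [laplaceDeriv_sinh_cosh_zero]

/-- The double inverse displays the value as a quotient of entire functions. -/
lemma betaIntegral_half {w : ℂ} (hw : 0 < w.re) : Complex.betaIntegral w (1 / 2) =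
    ((Complex.Gamma w)⁻¹)⁻¹ * (Complex.Gamma (1 / 2) * (Complex.Gamma (w + 1 / 2))⁻¹) := by
  rw [Complex.betaIntegral_eq_Gamma_mul_div _ _ hw (by simp), inv_inv, div_eq_mul_inv, mul_assoc]

lemma differentiable_absCpow {c : ℝ} (hc : c ≠ 0) : Differentiable ℂ fun s => absCpow s c := by
  simp only [fun s => absCpow_of_ne s hc]
  fun_prop

lemma absCpow_ne_zero (s : ℂ) {c : ℝ} (hc : c ≠ 0) : absCpow s c ≠ 0 := by
  rw [absCpow_of_ne s hc]
  exact Complex.exp_ne_zero _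

/-- For `2 < Re s` both sides solve the same initial value problem in `r`; the identity theorem
extends the equality to the half-plane of convergence. -/
lemma periodIntegral_two_mul_tanh {s : ℂ} (hs : -1 / 2 < s.re) {r : ℝ} (hr : 0 ≤ r) :
    periodIntegral (2 * Real.tanh r) s =
      ((Complex.Gamma ((s + 1) / 2))⁻¹)⁻¹ *
      (2 * Complex.Gamma (1 / 2) * absCpow s (2 / Real.cosh r) *
        (Complex.Gamma ((s + 1) / 2 + 1 / 2))⁻¹ * evenSol (s * (s + 1)) r) := by
  have hc : 2 / Real.cosh r ≠ 0 := div_ne_zero two_ne_zero (Real.cosh_pos r).ne'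
  have hU : IsOpen {s : ℂ | -1 / 2 < s.re} := isOpen_lt continuous_const Complex.continuous_re
  have hpre : IsPreconnected {s : ℂ | -1 / 2 < s.re} :=
    (convex_halfSpace_re_gt (-1 / 2)).isPreconnected
  have hG := Complex.differentiable_one_div_Gamma
  have hE := differentiable_evenSol r
  have hA := differentiable_absCpow hc
  refine AnalyticOnNhd.eqOn_of_preconnected_of_eventuallyEq (z₀ := 3)
    (f := periodIntegral (2 * Real.tanh r)) (g := fun s => ((Complex.Gamma ((s + 1) / 2))⁻¹)⁻¹ *
      (2 * Complex.Gamma (1 / 2) * absCpow s (2 / Real.cosh r) *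
        (Complex.Gamma ((s + 1) / 2 + 1 / 2))⁻¹ * evenSol (s * (s + 1)) r))
    (fun s hs => analyticAt_periodIntegral (Or.inr hs)) ?_ hpre
    (show -1 / 2 < (3 : ℂ).re by norm_num) ?_ hs
  · refine DifferentiableOn.analyticOnNhd (fun s hs => ?_) hU
    refine DifferentiableAt.differentiableWithinAt (DifferentiableAt.mul (.inv ?_ ?_) ?_)
    · exact (hG.comp (by fun_prop : Differentiable ℂ fun s : ℂ => (s + 1) / 2)).differentiableAt
    · refine inv_ne_zero (Complex.Gamma_ne_zero_of_re_pos ?_)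
      have : -1 / 2 < s.re := hs
      simp
      linarith
    · have h1 := hG.comp (by fun_prop : Differentiable ℂ fun s : ℂ => (s + 1) / 2 + 1 / 2)
      have h2 := hE.comp (by fun_prop : Differentiable ℂ fun s : ℂ => s * (s + 1))
      exact (((hA.const_mul _).mul h1).mul h2).differentiableAt
  · have : {s : ℂ | 2 < s.re} ∈ 𝓝 (3 : ℂ) :=
      (isOpen_lt continuous_const Complex.continuous_re).mem_nhds (by norm_num)
    filter_upwards [this] with s hs
    have hs : 2 < s.re := hs
    rw [Real.tanh_eq_sinh_div_cosh, periodIntegral_two_mul_div (Real.cosh_pos r).ne',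
      laplace_sinh_cosh hs hr, betaIntegral_half (by simp; linarith)]
    ring

/-! ### The zeros for `2 < |k|` and for `|k| < 2` -/

lemma periodIntegral_ne_zero_of_im_eq_zero {k : ℝ} (hk : 2 < |k|) {s : ℂ} (hs : s.im = 0) :
    periodIntegral k s ≠ 0 := by
  obtain ⟨t, rfl⟩ : ∃ t : ℝ, s = t := ⟨s.re, Complex.ext rfl (by simpa using hs)⟩
  have e : ∀ θ, absCpow t (k + 2 * Real.cos θ) = ((|k + 2 * Real.cos θ| ^ t : ℝ) : ℂ) :=
    fun θ => (Complex.ofReal_cpow (abs_nonneg _) t).symm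
  have hp : ∀ θ, 0 < |k + 2 * Real.cos θ| := fun θ =>
    abs_pos.2 (ofReal_add_two_mul_cos_ne_zero hk θ)
  rw [periodIntegral]
  simp only [e]
  rw [intervalIntegral.integral_ofReal]
  refine Complex.ofReal_ne_zero.2 (ne_of_gt ?_)
  refine intervalIntegral.intervalIntegral_pos_of_pos ?_ (fun θ => Real.rpow_pos_of_pos (hp θ) t)
    (by positivity)
  refine Continuous.intervalIntegrable ?_ _ _
  exact Continuous.rpow_const (by fun_prop) fun θ => Or.inl (hp θ).ne'

/-- With `|k| = 2 coth r`, a zero of the period integral is a zero of the Laplace integral for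
`(cosh, sinh)`, so that `s (s + 1)` is real; real `s` are excluded by positivity. -/
lemma re_eq_of_periodIntegral_eq_zero {k : ℝ} (hk : 2 < |k|) {s : ℂ} (h : periodIntegral k s = 0) :
    s.re = -1 / 2 := by
  have hk0 : 0 < |k| := by linarith
  have hk2 : 2 / |k| < 1 := by rw [div_lt_one hk0]; exact hk
  obtain ⟨r, hr, hrk⟩ : ∃ r : ℝ, 0 < r ∧ |k| = 2 * (Real.cosh r / Real.sinh r) := by
    have hmem : 2 / |k| ∈ Ioo (-1 : ℝ) 1 := ⟨by have : 0 < 2 / |k| := by positivity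
                                                linarith, hk2⟩
    refine ⟨Real.artanh (2 / |k|), Real.artanh_pos ⟨by positivity, hk2⟩, ?_⟩
    have := Real.tanh_artanh hmem
    rw [Real.tanh_eq_sinh_div_cosh] at this
    rw [← inv_div, this]
    field_simp
  have hsr : 0 < Real.sinh r := Real.sinh_pos_iff.2 hr
  have hne : ∀ r θ : ℝ, Real.cosh r + Real.sinh r * Real.cos θ ≠ 0 := by
    intro r θ
    have h1 : |Real.sinh r * Real.cos θ| < Real.cosh r := by
      rw [abs_mul]
      calc |Real.sinh r| * |Real.cos θ| ≤ |Real.sinh r| * 1 := by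
            gcongr
            exact Real.abs_cos_le_one θ
        _ < Real.cosh r := by
            rw [mul_one]
            refine abs_lt_of_sq_lt_sq ?_ (Real.cosh_pos r).le
            rw [Real.cosh_sq]
            linarith
    have := (abs_lt.1 h1).1
    linarith
  rw [← periodIntegral_abs, hrk, periodIntegral_two_mul_div hsr.ne'] at h
  have hz : laplace Real.cosh Real.sinh s r = 0 :=
    (mul_eq_zero.1 h).resolve_left (absCpow_ne_zero s (by positivity))
  have hd1 := hasDerivAt_laplace (s := s) Real.hasDerivAt_cosh Real.hasDerivAt_sinh
    (fun r θ => Or.inl (hne r θ))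
  have hd2 := hasDerivAt_mul_laplaceDeriv (s := s) (ε := -1) Real.hasDerivAt_cosh
    Real.hasDerivAt_sinh (fun r => by rw [Real.cosh_sq]; ring) (fun r θ => Or.inl (hne r θ))
  have him : (s * (s + 1)).im = 0 := by
    refine im_eq_zero_of_zero (p := Real.sinh) (y := laplace Real.cosh Real.sinh s)
      (h := fun r => (Real.sinh r : ℂ) * laplaceDeriv Real.cosh Real.sinh s r)
      hr (fun r hr => Real.sinh_pos_iff.2 hr.1) (fun r hr => ?_) (fun r _ => hd2 r)
      (fun r _ => (hd1 r).continuousAt.continuousWithinAt)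
      (fun r _ => (hd2 r).continuousAt.continuousWithinAt) (by simp) ?_ hz
    · refine (hd1 r).congr_deriv ?_
      rw [mul_div_cancel_left₀]
      exact_mod_cast (Real.sinh_pos_iff.2 hr.1).ne'
    · simp [laplace, absCpow, Real.pi_ne_zero]
  by_cases hs : s.im = 0
  · refine absurd ?_ (periodIntegral_ne_zero_of_im_eq_zero (k := |k|) (by rwa [abs_abs]) hs)
    rw [hrk, periodIntegral_two_mul_div hsr.ne', hz, mul_zero]
  · simp only [Complex.mul_im, Complex.add_im, Complex.add_re, Complex.one_im,
      Complex.one_re] at him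
    have : s.im * (2 * s.re + 1) = 0 := by linarith
    have := (mul_eq_zero.1 this).resolve_left hs
    linarith

/-- `l = s (s + 1)` real and less than `-1 / 4` means that `(s + 1 / 2)²` is a negative real. -/
lemma re_eq_of_evenSol_eq_zero {s : ℂ} {r : ℝ} (hr : 0 ≤ r) (h : evenSol (s * (s + 1)) r = 0) :
    s.re = -1 / 2 := by
  rcases hr.eq_or_lt with rfl | hr
  · simp [evenSol_zero] at h
  obtain ⟨him, hre⟩ := re_lt_of_zero_cosh hr (hasDerivAt_evenSol _) (hasDerivAt_evenFlux _)
    (evenFlux_zero _) (by simp [evenSol_zero]) h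
  simp only [Complex.mul_im, Complex.mul_re, Complex.add_im, Complex.add_re, Complex.one_im,
    Complex.one_re] at him hre
  have h1 : s.im * (2 * s.re + 1) = 0 := by linarith
  rcases mul_eq_zero.1 h1 with h2 | h2
  · rw [h2] at hre
    nlinarith [sq_nonneg (s.re + 1 / 2)]
  · linarith

/-! ### Quotients of entire functions and uniqueness of the continuation -/

lemma eq_zero_of_meromorphicOrderAt_pos {P Q : ℂ → ℂ} (hP : Differentiable ℂ P)
    (hP0 : ∃ z, P z ≠ 0) (hQ : Differentiable ℂ Q) {s : ℂ}
    (h : 0 < meromorphicOrderAt (fun z => (P z)⁻¹ * Q z) s) : Q s = 0 := by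
  by_contra hQs
  have hPa : ∀ z, AnalyticAt ℂ P z := fun z => hP.analyticAt z
  have htop : meromorphicOrderAt P s ≠ ⊤ := by
    obtain ⟨z, hz⟩ := hP0
    refine MeromorphicOn.meromorphicOrderAt_ne_top_of_isPreconnected (U := univ) (x := z)
      (fun z _ => (hPa z).meromorphicAt) isPreconnected_univ (mem_univ _) (mem_univ _) ?_
    rw [(hPa z).meromorphicOrderAt_eq, (hPa z).analyticOrderAt_eq_zero.2 hz]
    simp
  have hP' : 0 ≤ meromorphicOrderAt P s := (hPa s).meromorphicOrderAt_nonneg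
  have e : (fun z => (P z)⁻¹ * Q z) = Q * P⁻¹ := by
    ext z
    simp [mul_comm]
  rw [e, meromorphicOrderAt_mul_of_ne_zero (hQ.analyticAt s) hQs, meromorphicOrderAt_inv] at h
  lift meromorphicOrderAt P s to ℤ using htop with n
  norm_cast at h hP'
  omega

/-- Two continuations agree near `0`, so their difference has infinite order everywhere. -/
lemma IsW₁.meromorphicOrderAt_congr {k : ℝ} {W V : ℂ → ℂ} (hW : IsW₁ k W) (hV : IsW₁ k V) (s : ℂ) :
    meromorphicOrderAt W s = meromorphicOrderAt V s := by
  have hm : ∀ z, MeromorphicAt (W - V) z := fun z => (hW.1 z).sub (hV.1 z)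
  have h1 : meromorphicOrderAt (W - V) 0 = ⊤ := by
    rw [meromorphicOrderAt_eq_top_iff]
    have : {s : ℂ | -1 / 2 < s.re} ∈ 𝓝 (0 : ℂ) :=
      (isOpen_lt continuous_const Complex.continuous_re).mem_nhds (by norm_num)
    filter_upwards [nhdsWithin_le_nhds this] with z hz
    rw [Pi.sub_apply, hW.2 z hz, hV.2 z hz, sub_self]
  have h2 : meromorphicOrderAt (W - V) s = ⊤ := by
    by_contra h
    exact MeromorphicOn.meromorphicOrderAt_ne_top_of_isPreconnected (U := univ) (x := s)
      (fun z _ => hm z) isPreconnected_univ (mem_univ _) (mem_univ _) h h1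
  rw [meromorphicOrderAt_eq_top_iff] at h2
  refine _root_.meromorphicOrderAt_congr ?_
  filter_upwards [h2] with z hz using sub_eq_zero.1 hz

/-- The continuation as a quotient of entire functions. The denominator collects the reciprocal of
the Gamma function that carries the poles, and the numerator vanishes only at places of trivial
zeros or on the critical line. -/
lemma exists_quotient (k : ℝ) : ∃ P Q : ℂ → ℂ, Differentiable ℂ P ∧ (∃ z, P z ≠ 0) ∧
    Differentiable ℂ Q ∧ (∀ s : ℂ, -1 / 2 < s.re → zmfIntegral k s = (P s)⁻¹ * Q s) ∧
    ∀ s, Q s = 0 → s ∈ trivialZeros k ∨ s.re = -1 / 2 := by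
  have hπ : (2 * (π : ℂ))⁻¹ ≠ 0 := by simp [Real.pi_ne_zero]
  have hG := Complex.differentiable_one_div_Gamma
  have hG2 : Complex.Gamma (1 / 2) ≠ 0 := Complex.Gamma_ne_zero_of_re_pos (by simp)
  rcases lt_trichotomy |k| 2 with hk | hk | hk
  -- The poles come from `Γ((s + 1) / 2)`, the trivial zeros from `1 / Γ(s / 2 + 1)`.
  · set r := Real.artanh (|k| / 2) with hrdef
    have hmem : |k| / 2 ∈ Ioo (-1 : ℝ) 1 := ⟨by linarith [abs_nonneg k], by linarith⟩
    have hr : 0 ≤ r := Real.artanh_nonneg (by positivity)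
    have hkr : |k| = 2 * Real.tanh r := by
      rw [hrdef, Real.tanh_artanh hmem]
      ring
    have hc : 2 / Real.cosh r ≠ 0 := div_ne_zero two_ne_zero (Real.cosh_pos r).ne'
    refine ⟨fun s => (Complex.Gamma ((s + 1) / 2))⁻¹, fun s => (2 * (π : ℂ))⁻¹ *
      (2 * Complex.Gamma (1 / 2) * absCpow s (2 / Real.cosh r) *
        (Complex.Gamma ((s + 1) / 2 + 1 / 2))⁻¹ * evenSol (s * (s + 1)) r),
      hG.comp (by fun_prop : Differentiable ℂ fun s : ℂ => (s + 1) / 2), ⟨1, by simp⟩, ?_,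
      fun s hs => ?_, fun s hs => ?_⟩
    · have h1 := hG.comp (by fun_prop : Differentiable ℂ fun s : ℂ => (s + 1) / 2 + 1 / 2)
      have h2 := (differentiable_evenSol r).comp
        (by fun_prop : Differentiable ℂ fun s : ℂ => s * (s + 1))
      exact ((((differentiable_absCpow hc).const_mul _).mul h1).mul h2).const_mul _
    · rw [zmfIntegral_eq, ← periodIntegral_abs, hkr, periodIntegral_two_mul_tanh hs hr]
      ring
    · rcases mul_eq_zero.1 ((mul_eq_zero.1 hs).resolve_left hπ) with h | h
      · left
        have h1 := (mul_eq_zero.1 h).resolve_left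
          (mul_ne_zero (mul_ne_zero two_ne_zero hG2) (absCpow_ne_zero s hc))
        obtain ⟨m, hm⟩ := (Complex.Gamma_eq_zero_iff _).1 (inv_eq_zero.1 h1)
        exact Or.inr ⟨hk, m, by linear_combination 2 * hm⟩
      · exact Or.inr (re_eq_of_evenSol_eq_zero hr h)
  -- The integral is a Beta integral, and the trivial zeros come from `1 / Γ(s + 1)`.
  · refine ⟨fun s => (Complex.Gamma (s + 1 / 2))⁻¹, fun s => (2 * (π : ℂ))⁻¹ *
      (2 * Complex.Gamma (1 / 2) * absCpow s 4 * (Complex.Gamma (s + 1 / 2 + 1 / 2))⁻¹),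
      hG.comp (by fun_prop : Differentiable ℂ fun s : ℂ => s + 1 / 2),
      ⟨1 / 2, by norm_num⟩, ?_, fun s hs => ?_, fun s hs => ?_⟩
    · have h1 := hG.comp (by fun_prop : Differentiable ℂ fun s : ℂ => s + 1 / 2 + 1 / 2)
      exact (((differentiable_absCpow four_ne_zero).const_mul _).mul h1).const_mul _
    · rw [zmfIntegral_eq, ← periodIntegral_abs, hk, periodIntegral_two hs,
        betaIntegral_half (by simp; linarith)]
      ring
    · left
      have h1 := (mul_eq_zero.1 ((mul_eq_zero.1 hs).resolve_left hπ)).resolve_left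
          (mul_ne_zero (mul_ne_zero two_ne_zero hG2) (absCpow_ne_zero s four_ne_zero))
      obtain ⟨m, hm⟩ := (Complex.Gamma_eq_zero_iff _).1 (inv_eq_zero.1 h1)
      exact Or.inl ⟨hk, m, by linear_combination hm⟩
  -- The base does not vanish, and the integral is entire in `s`.
  · refine ⟨fun _ => 1, fun s => (2 * (π : ℂ))⁻¹ * periodIntegral k s, differentiable_const 1,
      ⟨0, one_ne_zero⟩, ?_, fun s hs => ?_, fun s hs => ?_⟩
    · exact fun s => (analyticAt_periodIntegral (Or.inl hk)).differentiableAt.const_mul _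
    · rw [zmfIntegral_eq, inv_one, one_mul]
    · exact Or.inr (re_eq_of_periodIntegral_eq_zero hk ((mul_eq_zero.1 hs).resolve_left hπ))

end ZetaMahler

theorem theorem1p3 (k : ℝ) :
    (∀ s : ℂ, -1 / 2 < s.re → CircleIntegrable (zmfIntegrand k s) 0 1) ∧
    (∃ W : ℂ → ℂ, IsW₁ k W) ∧
    ∀ W : ℂ → ℂ, IsW₁ k W →
      ∀ s : ℂ, IsMeromorphicZero W s → s ∉ trivialZeros k → s.re = -1 / 2 := by
  obtain ⟨P, Q, hP, hP0, hQ, hPQ, hzero⟩ := ZetaMahler.exists_quotient k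
  have hV : IsW₁ k fun s => (P s)⁻¹ * Q s :=
    ⟨fun s => (hP.analyticAt s).meromorphicAt.inv.mul (hQ.analyticAt s).meromorphicAt,
      fun s hs => (hPQ s hs).symm⟩
  refine ⟨fun s => ZetaMahler.circleIntegrable_zmfIntegrand k, ⟨_, hV⟩, fun W hW s hs htriv => ?_⟩
  rw [IsMeromorphicZero, ZetaMahler.IsW₁.meromorphicOrderAt_congr hW hV s] at hs
  exact (hzero s (ZetaMahler.eq_zero_of_meromorphicOrderAt_pos hP hP0 hQ hs)).resolve_left htriv
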